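/- Let $d\ge 2$ be an integer, let $c$ be the conjugacy class of transpositions in the symmetric group $\mathfrak S_d$, and let $k$ be an algebraically closed field. The braid group $B_n$ acts on $\mathfrak S_d^{\,n}$ by $\sigma_i.(g_1,\dots,g_n)=(g_1,\dots,g_{i-1},\,g_ig_{i+1}g_i^{-1},\,g_i,\,g_{i+2},\dots,g_n)$. Let $\mathrm{Comp}(\mathfrak S_d,c)$ be the (commutative) monoid whose elements are the $B_n$-orbits, for all $n\ge 0$, of tuples $(g_1,\dots,g_n)\in c^n$ with $g_1g_2\cdots g_n=1$, with the product induced by concatenation of tuples, and let $R(\mathfrak S_d,c)=k[\mathrm{Comp}(\mathfrak S_d,c)]$ be its monoid ring, called the ring of components. For $1\le i<j\le d$ let $X_{ij}\in R(\mathfrak S_d,c)$ be the orbit of the pair $((i\,j),(i\,j))$. The elements $X_{ij}$ generate $R(\mathfrak S_d,c)$ as a $k$-algebra, so they identify $\mathrm{Spec}\,R(\mathfrak S_d,c)$ with a closed subscheme of $\mathbb A^{d(d-1)/2}_k$, whose coordinates are indexed by the pairs $(i,j)$ with $1\le i<j\le d$; a $k$-point, i.e. a $k$-algebra homomorphism $\varphi\colon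 R(\mathfrak S_d,c)\to k$, corresponds to the point $(\varphi(X_{ij}))_{i<j}$. Let $e_{i,j}$ be the basis vectors of $k^{d(d-1)/2}$ and, for $A\subseteq\{1,\dots,d\}$, put $$e_A=\sum_{\substack{1\le i<j\le d\\ i,j\in A}}e_{i,j}.$$ Then, as a subset of $\mathbb A^{d(d-1)/2}(k)=k^{d(d-1)/2}$, $$(\mathrm{Spec}\,R(\mathfrak S_d,c))(k)=\bigcup_{A_1,\dots,A_l}\mathrm{Span}_k(e_{A_1},\dots,e_{A_l}),$$ where the union is over all finite families $A_1,\dots,A_l$ ($l\ge 0$) of pairwise disjoint subsets of $\{1,\dots,d\}$. In particular, the (topological) Krull dimension of $(\mathrm{Spec}\,R(\mathfrak S_d,c))(k)$, equipped with the Zariski topology, is $\lfloor d/2\rfloor$. -/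

import Mathlib

/-- The defining relators of the Artin braid group on `n` strands, whose generators
`σ_1, …, σ_{n-1}` are indexed here by `0, …, n-2`. -/
def braidRelators (n : ℕ) : Set (FreeGroup (Fin (n - 1))) :=
  {r | (∃ i j : Fin (n - 1), (i : ℕ) + 1 < j ∧
          r = .of i * .of j * (.of j * .of i)⁻¹) ∨
       (∃ i j : Fin (n - 1), (i : ℕ) + 1 = j ∧
          r = .of i * .of j * .of i * (.of j * .of i * .of j)⁻¹)}

/-- The Artin braid group `B_n`. -/
abbrev BraidGroup (n : ℕ) : Type := PresentedGroup (braidRelators n)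

section Braid

variable {G : Type*} [Group G]

/-- The move `(…, a, b, …) ↦ (…, a b a⁻¹, a, …)` at positions `i, i + 1`. -/
def hurwitzFun {n : ℕ} (i : Fin (n - 1)) (g : Fin n → G) : Fin n → G := fun j =>
  if (j : ℕ) = i then
    g ⟨i, by omega⟩ * g ⟨i + 1, by omega⟩ * (g ⟨i, by omega⟩)⁻¹
  else if (j : ℕ) = i + 1 then g ⟨i, by omega⟩ else g j

/-- The inverse move `(…, a, b, …) ↦ (…, b, b⁻¹ a b, …)`. -/
def hurwitzInv {n : ℕ} (i : Fin (n - 1)) (g : Fin n → G) : Fin n → G := fun j =>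
  if (j : ℕ) = i then g ⟨i + 1, by omega⟩
  else if (j : ℕ) = i + 1 then
    (g ⟨i + 1, by omega⟩)⁻¹ * g ⟨i, by omega⟩ * g ⟨i + 1, by omega⟩
  else g j

/-- The permutation of `G^n` by which the generator `σ_i` acts. -/
def hurwitzMove {n : ℕ} (i : Fin (n - 1)) : Equiv.Perm (Fin n → G) where
  toFun := hurwitzFun i
  invFun := hurwitzInv i
  left_inv g := by
    funext ⟨j, hj⟩
    by_cases h1 : j = (i : ℕ)
    · subst h1
      simp [hurwitzFun, hurwitzInv]
    · by_cases h2 : j = (i : ℕ) + 1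
      · subst h2
        simp [hurwitzFun, hurwitzInv, mul_assoc]
      · simp [hurwitzFun, hurwitzInv, h1, h2]
  right_inv g := by
    funext ⟨j, hj⟩
    by_cases h1 : j = (i : ℕ)
    · subst h1
      simp [hurwitzFun, hurwitzInv, mul_assoc]
    · by_cases h2 : j = (i : ℕ) + 1
      · subst h2
        simp [hurwitzFun, hurwitzInv]
      · simp [hurwitzFun, hurwitzInv, h1, h2]

theorem hurwitzMove_apply {n : ℕ} (i : Fin (n - 1)) (g : Fin n → G) (j : Fin n) :
    hurwitzMove i g j = if (j : ℕ) = i then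
        g ⟨i, by omega⟩ * g ⟨i + 1, by omega⟩ * (g ⟨i, by omega⟩)⁻¹
      else if (j : ℕ) = i + 1 then g ⟨i, by omega⟩ else g j := rfl

theorem hurwitzMove_comm {n : ℕ} (i j : Fin (n - 1)) (h : (i : ℕ) + 1 < j) :
    (hurwitzMove i * hurwitzMove j : Equiv.Perm (Fin n → G)) =
      hurwitzMove j * hurwitzMove i := by
  ext g m
  simp only [Equiv.Perm.mul_apply, hurwitzMove_apply]
  grind

theorem hurwitzMove_braid {n : ℕ} (i j : Fin (n - 1)) (h : (i : ℕ) + 1 = j) :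
    (hurwitzMove i * hurwitzMove j * hurwitzMove i : Equiv.Perm (Fin n → G)) =
      hurwitzMove j * hurwitzMove i * hurwitzMove j := by
  obtain ⟨i, hi⟩ := i
  obtain ⟨j, hj⟩ := j
  simp only at h
  subst h
  have e1 : ¬ i = i + 1 + 1 := by omega
  have e2 : ¬ i + 1 + 1 = i := by omega
  ext g m
  simp only [Equiv.Perm.mul_apply, hurwitzMove_apply]
  by_cases h1 : (m : ℕ) = i
  · simp [e1, e2, h1, mul_assoc]
  · by_cases h2 : (m : ℕ) = i + 1
    · simp [e1, e2, h2]
    · by_cases h3 : (m : ℕ) = i + 1 + 1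
      · simp [e1, e2, h3]
      · simp [h1, h2, h3]

/-- The left action of the braid group `B_n` on `G^n`, given on generators by
`σ_i . (g_1, …, g_n) = (g_1, …, g_i g_{i+1} g_i⁻¹, g_i, …, g_n)`. -/
def braidAction (G : Type*) [Group G] (n : ℕ) : BraidGroup n →* Equiv.Perm (Fin n → G) :=
  PresentedGroup.toGroup (f := hurwitzMove) (by
    rintro r (⟨i, j, h, rfl⟩ | ⟨i, j, h, rfl⟩)
    · simp only [map_mul, map_inv, FreeGroup.lift_apply_of, mul_inv_eq_one]
      exact hurwitzMove_comm i j h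
    · simp only [map_mul, map_inv, FreeGroup.lift_apply_of, mul_inv_eq_one]
      exact hurwitzMove_braid i j h)

/-- Two tuples (of arbitrary length, written as lists) are equivalent when they have the same
length `n` and lie in the same orbit of `B_n`. -/
def BraidEquiv (l l' : List G) : Prop :=
  ∃ (n : ℕ) (g : Fin n → G) (σ : BraidGroup n),
    List.ofFn g = l ∧ List.ofFn (braidAction G n σ g) = l'

theorem BraidEquiv.refl (l : List G) : BraidEquiv l l :=
  ⟨l.length, l.get, 1, by simp, by simp⟩

theorem BraidEquiv.symm {l l' : List G} (h : BraidEquiv l l') : BraidEquiv l' l := by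
  obtain ⟨n, g, σ, rfl, rfl⟩ := h
  exact ⟨n, _, σ⁻¹, rfl, by simp⟩

theorem BraidEquiv.trans {l l' l'' : List G} (h : BraidEquiv l l') (h' : BraidEquiv l' l'') :
    BraidEquiv l l'' := by
  obtain ⟨n, g, σ, rfl, rfl⟩ := h
  obtain ⟨m, g', τ, h1, rfl⟩ := h'
  have hm : m = n := by simpa using congrArg List.length h1
  subst hm
  have := List.ofFn_injective h1
  subst this
  exact ⟨m, g, τ * σ, rfl, by simp⟩

/-- A generator of the braid group acts on lists by replacing two consecutive entries. -/
theorem ofFn_hurwitzMove {n : ℕ} (i : Fin (n - 1)) (g : Fin n → G) :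
    ∃ (u v : List G) (a b : G), u.length = i ∧ List.ofFn g = u ++ a :: b :: v ∧
      List.ofFn (hurwitzMove i g) = u ++ (a * b * a⁻¹) :: a :: v := by
  refine ⟨(List.ofFn g).take i, (List.ofFn g).drop (i + 2), g ⟨i, by omega⟩,
    g ⟨i + 1, by omega⟩, ?_, ?_, ?_⟩
  · simp; omega
  · apply List.ext_getElem
    · simp; omega
    · intro m h1 h2
      simp only [List.getElem_append, List.getElem_cons, List.getElem_ofFn, List.getElem_take,
        List.getElem_drop, List.length_take, List.length_ofFn]
      have := i.2
      grind
  · apply List.ext_getElem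
    · simp; omega
    · intro m h1 h2
      simp only [List.getElem_append, List.getElem_cons, List.getElem_ofFn, List.getElem_take,
        List.getElem_drop, List.length_take, List.length_ofFn, hurwitzMove_apply]
      have := i.2
      grind

theorem BraidEquiv.step (u v : List G) (a b : G) :
    BraidEquiv (u ++ a :: b :: v) (u ++ (a * b * a⁻¹) :: a :: v) := by
  have hi : u.length < (u ++ a :: b :: v).length - 1 := by simp
  obtain ⟨u', v', a', b', hu, h1, h2⟩ :=
    ofFn_hurwitzMove ⟨u.length, hi⟩ (u ++ a :: b :: v).get
  rw [List.ofFn_get] at h1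
  obtain ⟨rfl, h3⟩ := List.append_inj h1 hu.symm
  simp only [List.cons.injEq] at h3
  obtain ⟨rfl, rfl, rfl⟩ := h3
  exact ⟨_, _, .of ⟨u.length, hi⟩, List.ofFn_get _, by simpa [braidAction] using h2⟩

theorem BraidEquiv.context {l l' : List G} (h : BraidEquiv l l') (u v : List G) :
    BraidEquiv (u ++ l ++ v) (u ++ l' ++ v) := by
  obtain ⟨n, g, σ, rfl, rfl⟩ := h
  have hσ : σ ∈ Subgroup.closure (Set.range (PresentedGroup.of (rels := braidRelators n))) := by
    rw [PresentedGroup.closure_range_of]; trivial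
  induction hσ using Subgroup.closure_induction generalizing g with
  | mem x hx =>
    obtain ⟨i, rfl⟩ := hx
    obtain ⟨p, q, a, b, -, h1, h2⟩ := ofFn_hurwitzMove i g
    have h3 : braidAction G n (.of i) g = hurwitzMove i g := by simp [braidAction]
    rw [h3, h1, h2]
    simpa using BraidEquiv.step (u ++ p) (q ++ v) a b
  | one => simpa using BraidEquiv.refl _
  | mul x y _ _ hx hy =>
    rw [map_mul, Equiv.Perm.mul_apply]
    exact (hy g).trans (hx _)
  | inv x _ hx => simpa using (hx (braidAction G n x⁻¹ g)).symm

/-- Braid equivalence is compatible with concatenation of tuples. -/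
def braidCon (G : Type*) [Group G] : Con (FreeMonoid G) where
  r x y := BraidEquiv x.toList y.toList
  iseqv := ⟨fun _ => .refl _, .symm, .trans⟩
  mul' {w x y z} h h' := by
    simp only [FreeMonoid.toList_mul]
    have h1 := h.context [] y.toList
    have h2 := h'.context x.toList []
    simp only [List.nil_append, List.append_nil] at h1 h2
    exact h1.trans h2

/-- The tuples `(g_1, …, g_n)` of elements of `c` with `g_1 ⋯ g_n = 1`, under concatenation. -/
def componentTuples (c : Set G) : Submonoid (FreeMonoid G) where
  carrier := {x | (∀ g ∈ x.toList, g ∈ c) ∧ x.toList.prod = 1}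
  one_mem' := by simp
  mul_mem' := by
    rintro x y ⟨hx, hx'⟩ ⟨hy, hy'⟩
    refine ⟨fun g hg => ?_, by simp [hx', hy']⟩
    rw [FreeMonoid.toList_mul, List.mem_append] at hg
    exact hg.elim (hx g) (hy g)

/-- The monoid of components of `(G, c)`, for a conjugacy class `c` of `G`: its elements are the
braid group orbits of tuples of elements of `c` with product `1`, and its product is induced by
concatenation. -/
abbrev Components (c : Set G) : Type _ :=
  ((braidCon G).comap (componentTuples c).subtype (map_mul _)).Quotient

theorem BraidEquiv.move_cons (a : G) (l : List G) :
    BraidEquiv (a :: l) (l.map (fun b => a * b * a⁻¹) ++ [a]) := by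
  induction l with
  | nil => exact .refl _
  | cons b l ih =>
    have h1 := BraidEquiv.step [] l a b
    have h2 := ih.context [a * b * a⁻¹] []
    simp only [List.nil_append, List.append_nil, List.singleton_append] at h1 h2
    simpa using h1.trans h2

theorem BraidEquiv.move_append (l l' : List G) :
    BraidEquiv (l ++ l') (l'.map (fun b => l.prod * b * l.prod⁻¹) ++ l) := by
  induction l with
  | nil => simpa using BraidEquiv.refl l'
  | cons a l ih =>
    have h1 := ih.context [a] []
    have h2 := (BraidEquiv.move_cons a (l'.map (fun b => l.prod * b * l.prod⁻¹))).context [] l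
    simp only [List.nil_append, List.append_nil, List.singleton_append] at h1 h2
    simpa [Function.comp_def, mul_assoc] using h1.trans h2

/-- The monoid of components is commutative, since tuples of product `1` can be moved freely. -/
instance (c : Set G) : CommMonoid (Components c) where
  mul_comm x y := by
    induction x, y using Con.induction_on₂ with
    | H x y =>
      rw [← Con.coe_mul, ← Con.coe_mul, Con.eq]
      change BraidEquiv (FreeMonoid.toList (x.1 * y.1)) (FreeMonoid.toList (y.1 * x.1))
      have h := BraidEquiv.move_append x.1.toList y.1.toList
      rw [x.2.2] at h
      simpa using h

end Braid

/-- The ring of components `R(G, c)`: the monoid ring of the monoid of components. -/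
abbrev RingOfComponents (k : Type*) [CommRing k] {G : Type*} [Group G] (c : Set G) : Type _ :=
  MonoidAlgebra k (Components c)

/-- The `k`-points of the spectrum of a commutative `k`-algebra `R`, that is, the `k`-algebra
homomorphisms `R → k`. -/
def KPoints (k R : Type*) [Field k] [CommRing R] [Algebra k R] : Type _ := R →ₐ[k] k

/-- The point of the prime spectrum underlying a `k`-point. -/
def KPoints.toSpec {k R : Type*} [Field k] [CommRing R] [Algebra k R] (x : KPoints k R) :
    PrimeSpectrum R :=
  ⟨RingHom.ker (show R →ₐ[k] k from x), RingHom.ker_isPrime _⟩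

/-- The Zariski topology on the set of `k`-points. -/
instance (k R : Type*) [Field k] [CommRing R] [Algebra k R] : TopologicalSpace (KPoints k R) :=
  TopologicalSpace.induced KPoints.toSpec inferInstance

/-- The conjugacy class of transpositions in the symmetric group on `d` letters. -/
def transpositions (d : ℕ) : Set (Equiv.Perm (Fin d)) := {σ | σ.IsSwap}

/-- The `d (d - 1) / 2` pairs `(i, j)` with `i < j`. -/
abbrev IndexPair (d : ℕ) : Type := {p : Fin d × Fin d // p.1 < p.2}

/-- The component represented by the pair of transpositions `((i j), (i j))`. -/
def pairComponent {d : ℕ} (p : IndexPair d) : Components (transpositions d) :=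
  Con.toQuotient (⟨FreeMonoid.ofList [Equiv.swap p.1.1 p.1.2, Equiv.swap p.1.1 p.1.2], by
    have h : Equiv.swap p.1.1 p.1.2 ∈ transpositions d := ⟨p.1.1, p.1.2, p.2.ne, rfl⟩
    exact ⟨by simpa using h, by simp⟩⟩ : componentTuples (transpositions d))

/-- The element `X_{ij}` of the ring of components of the symmetric group. -/
noncomputable def generatorX (k : Type*) [Field k] {d : ℕ} (p : IndexPair d) :
    RingOfComponents k (transpositions d) :=
  MonoidAlgebra.of k _ (pairComponent p)

/-- The point of affine space whose coordinates are the values of the functions `X_{ij}` at a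
`k`-point of the spectrum of the ring of components. -/
noncomputable def affineCoords (k : Type*) [Field k] (d : ℕ)
    (x : KPoints k (RingOfComponents k (transpositions d))) : IndexPair d → k :=
  fun p => (show RingOfComponents k (transpositions d) →ₐ[k] k from x) (generatorX k p)

/-- The vector `e_A`, the sum of the basis vectors `e_{ij}` with `i < j` and `i, j ∈ A`. -/
noncomputable def subsetVector (k : Type*) [Field k] {d : ℕ} (A : Finset (Fin d)) :
    IndexPair d → k :=
  ∑ p : IndexPair d with p.1.1 ∈ A ∧ p.1.2 ∈ A, Pi.single p 1

/-!
A tuple of transpositions of product `1` can be braided, one moved point at a time, until two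
neighbouring entries are equal (`BraidEquiv.exists_pair`). By induction on the length, the monoid
of components is generated by the classes `X_{ij}` of the pairs `((i j), (i j))`.

Moving a pair of product `1` around a transposition conjugates the pair, which gives the relations
`X_{ij} X_{jm} = X_{ij} X_{im}` (`doubled_mul_doubled`). Under a homomorphism to a domain they
say that "`X_{ij}` is not sent to zero" is an equivalence relation on indices and that the value
of `X_{ij}` depends only on the class (`exists_blocks_of_algHom`). For the domain `k` this puts
every point in the span of the vectors `e_A` of the classes `A`. Conversely, give a transposition
whose support lies in the block `A m` the weight `s m`, a square root of the wanted coefficient,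
and weight zero to the other transpositions. A transposition of nonzero weight preserves all the
blocks, so the product of the weights of a tuple is invariant under braids, and it defines a point
(`weightAlgHom`).

For the dimension, the same description of homomorphisms to domains shows that the quotient of the
ring by a prime ideal is generated by one element for each class with at least two elements. There
are at most `d / 2` of these, so the ring, and with it the space of `k`-points, has dimension at
most `d / 2`. The points attached to the blocks `{0, 1}, {2, 3}, …`, filtered by the number of
blocks allowed a nonzero weight, have closures that form a chain of irreducible closed sets of
length `d / 2`.
-/

open Equiv

/-! ### Braid equivalence of tuples -/

section BraidInvariants

variable {G : Type*} [Group G]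

/-- A function on tuples that is unchanged by every elementary move is constant on braid group
orbits. -/
theorem BraidEquiv.apply_eq {α : Type*} (f : List G → α)
    (hf : ∀ u v a b, f (u ++ (a * b * a⁻¹) :: a :: v) = f (u ++ a :: b :: v))
    {l l' : List G} (h : BraidEquiv l l') : f l' = f l := by
  obtain ⟨n, g, σ, rfl, rfl⟩ := h
  have hσ : σ ∈ Subgroup.closure (Set.range (PresentedGroup.of (rels := braidRelators n))) := by
    rw [PresentedGroup.closure_range_of]; trivial
  induction hσ using Subgroup.closure_induction generalizing g with
  | mem x hx =>
    obtain ⟨i, rfl⟩ := hx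
    obtain ⟨p, q, a, b, -, h1, h2⟩ := ofFn_hurwitzMove i g
    have h3 : braidAction G n (.of i) g = hurwitzMove i g := by simp [braidAction]
    rw [h3, h1, h2, hf]
  | one => simp
  | mul x y _ _ hx hy =>
    rw [map_mul, Perm.mul_apply, hx, hy]
  | inv x _ hx => simpa using (hx (braidAction G n x⁻¹ g)).symm

theorem BraidEquiv.prod_eq {l l' : List G} (h : BraidEquiv l l') : l'.prod = l.prod :=
  h.apply_eq List.prod fun u v a b => by simp [mul_assoc]

theorem BraidEquiv.length_eq {l l' : List G} (h : BraidEquiv l l') : l'.length = l.length :=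
  h.apply_eq List.length fun u v a b => by simp

theorem BraidEquiv.forall_mem {S : Set G} (hS : ∀ a ∈ S, ∀ b, a * b * a⁻¹ ∈ S ↔ b ∈ S)
    {l l' : List G} (h : BraidEquiv l l') (hl : ∀ g ∈ l, g ∈ S) : ∀ g ∈ l', g ∈ S := by
  refine (h.apply_eq (fun l => ∀ g ∈ l, g ∈ S) fun u v a b => propext ?_).mpr hl
  simp only [List.mem_append, List.mem_cons, or_imp, forall_and, forall_eq]
  grind

theorem BraidEquiv.cons (a : G) {l l' : List G} (h : BraidEquiv l l') :
    BraidEquiv (a :: l) (a :: l') := by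
  simpa using h.context [a] []

/-- The pair `(s, s)`, of product `1`, can be moved around the last entry of `(t, t)`: this
conjugates it by `t`. -/
theorem BraidEquiv.conj_pair {s : G} (hs : s * s = 1) (t : G) :
    BraidEquiv [t, t, s, s] [t, t, t * s * t⁻¹, t * s * t⁻¹] := by
  have h1 : BraidEquiv [t, s, s] [t * s * t⁻¹, t * s * t⁻¹, t] := BraidEquiv.move_cons t [s, s]
  have h2 := BraidEquiv.move_append [t * s * t⁻¹, t * s * t⁻¹] [t]
  have h3 : t * s * t⁻¹ * (t * s * t⁻¹) = 1 := by
    rw [conj_mul, hs, mul_one, mul_inv_cancel]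
  simp only [List.prod_cons, List.prod_nil, mul_one, h3] at h2
  simp only [List.map_cons, List.map_nil, one_mul, inv_one, mul_one, List.cons_append,
    List.nil_append] at h2
  exact (h1.trans h2).cons t

end BraidInvariants

/-! ### Tuples of transpositions of product one -/

section Transpositions

variable {α : Type*} [DecidableEq α]

theorem Equiv.Perm.IsSwap.eq_swap_of_apply_ne {g : Perm α} (hg : g.IsSwap) {a : α}
    (h : g a ≠ a) : g = swap a (g a) := by
  obtain ⟨x, y, hxy, rfl⟩ := hg
  rcases eq_or_ne a x with rfl | hx
  · simp
  · rcases eq_or_ne a y with rfl | hy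
    · simp [swap_comm]
    · exact absurd (swap_apply_of_ne_of_ne hx hy) h

theorem Equiv.Perm.IsSwap.conj_mem_iff {a : Perm α} (b : Perm α) :
    (a * b * a⁻¹).IsSwap ↔ b.IsSwap := by
  constructor
  · rintro ⟨x, y, hxy, h⟩
    refine ⟨a⁻¹ x, a⁻¹ y, by simpa, ?_⟩
    rw [Equiv.swap_apply_apply, ← h]
    group
  · rintro ⟨x, y, hxy, rfl⟩
    exact ⟨a x, a y, by simpa, by rw [Equiv.swap_apply_apply]⟩

/-- Up to braid equivalence, either a tuple of transpositions starts with two equal entries, or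
at most one of its entries moves the point `a`, and that entry comes first. -/
theorem BraidEquiv.exists_pair_or_fixes (a : α) (l : List (Perm α)) (hl : ∀ g ∈ l, g.IsSwap) :
    (∃ t l', BraidEquiv l (t :: t :: l')) ∨
    (∃ l', BraidEquiv l l' ∧ ∀ g ∈ l', g a = a) ∨
    (∃ x l', x ≠ a ∧ BraidEquiv l (swap a x :: l') ∧ ∀ g ∈ l', g a = a) := by
  induction l with
  | nil => exact .inr (.inl ⟨[], .refl _, by simp⟩)
  | cons g l ih =>
    simp only [List.mem_cons, forall_eq_or_imp] at hl
    have hg := hl.1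
    rcases ih hl.2 with ⟨t, l', h⟩ | ⟨l', h, hf⟩ | ⟨x, l', hx, h, hf⟩
    · refine .inl ⟨g * t * g⁻¹, g :: l', (h.cons g).trans ?_⟩
      simpa using (BraidEquiv.move_cons g [t, t]).context [] l'
    · by_cases hga : g a = a
      · exact .inr (.inl ⟨g :: l', h.cons g, by simpa [hga] using hf⟩)
      · refine .inr (.inr ⟨g a, l', hga, ?_, hf⟩)
        rw [← hg.eq_swap_of_apply_ne hga]
        exact h.cons g
    · by_cases hga : g a = a
      · refine .inr (.inr ⟨g x, g :: l', fun h => hx (g.injective (h.trans hga.symm)), ?_,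
          by simpa [hga] using hf⟩)
        have h1 := BraidEquiv.step [] l' g (swap a x)
        rw [← Equiv.swap_apply_apply, hga] at h1
        exact (h.cons g).trans h1
      · have hgs := hg.eq_swap_of_apply_ne hga
        rcases eq_or_ne (g a) x with rfl | hgx
        · rw [← hgs] at h
          exact .inl ⟨g, l', h.cons g⟩
        · -- The inverse move turns `(a y), (a x)` into `(a x), (x y)`.
          refine .inr (.inr ⟨x, swap x (g a) :: l', hx, (h.cons g).trans ?_, ?_⟩)
          · have h1 := BraidEquiv.step [] l' (swap a x) (swap x (g a))
            rw [← Equiv.swap_apply_apply, swap_apply_right, swap_apply_of_ne_of_ne hga hgx,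
              ← hgs] at h1
            exact h1.symm
          · simpa [swap_apply_of_ne_of_ne hx.symm (Ne.symm hga)] using hf

/-- A nonempty tuple of transpositions of product `1` is braid equivalent to one that starts with
two equal entries. -/
theorem BraidEquiv.exists_pair [Finite α] {l : List (Perm α)} (hne : l ≠ [])
    (hl : ∀ g ∈ l, g.IsSwap) (hprod : l.prod = 1) : ∃ t l', BraidEquiv l (t :: t :: l') := by
  have := Fintype.ofFinite α
  -- Induct on a set `S` of points outside which no entry moves anything.
  suffices H : ∀ (S : Finset α) (l : List (Perm α)), l ≠ [] → (∀ g ∈ l, g.IsSwap) →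
      (∀ g ∈ l, g ∈ fixingSubgroup (Perm α) (Sᶜ : Set α)) → l.prod = 1 →
      ∃ t l', BraidEquiv l (t :: t :: l') from
    H Finset.univ l hne hl (by simp) hprod
  intro S
  induction S using Finset.induction_on with
  | empty =>
    intro l hne hl hS _
    obtain ⟨g, hg⟩ := List.exists_mem_of_ne_nil l hne
    obtain ⟨x, y, hxy, rfl⟩ := hl g hg
    have := hS _ hg
    rw [mem_fixingSubgroup_iff] at this
    exact absurd (by simpa using this x (by simp)) hxy.symm
  | insert a S _ ih =>
    intro l hne hl hS hprod
    rcases exists_pair_or_fixes a l hl with h | ⟨l', h, hf⟩ | ⟨x, l', hx, h, hf⟩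
    · exact h
    · have hne' : l' ≠ [] := by
        rw [← List.length_pos_iff] at hne ⊢
        rwa [h.length_eq]
      have hl' := h.forall_mem (S := {g : Perm α | g.IsSwap})
        (fun _ _ b => Perm.IsSwap.conj_mem_iff b) hl
      have hS' := h.forall_mem (S := fixingSubgroup (Perm α) ((insert a S : Finset α) : Set α)ᶜ)
        (fun g hg b => by
          rw [SetLike.mem_coe] at hg
          rw [SetLike.mem_coe, SetLike.mem_coe, Subgroup.mul_mem_cancel_right _ (inv_mem hg),
            Subgroup.mul_mem_cancel_left _ hg])
        hS
      obtain ⟨t, l'', h'⟩ := ih l' hne' hl' (fun g hg => by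
        have h1 := hS' g hg
        simp only [SetLike.mem_coe, mem_fixingSubgroup_iff] at h1 ⊢
        intro y hy
        rcases eq_or_ne y a with rfl | hya
        · exact hf g hg
        · exact h1 y (by simp_all)) (h.prod_eq.trans hprod)
      exact ⟨t, l'', h.trans h'⟩
    · -- The product of the tuple sends `a` to `x`.
      have h1 : l'.prod ∈ MulAction.stabilizer (Perm α) a := Subgroup.list_prod_mem _ hf
      have h2 : swap a x * l'.prod = 1 := by
        rw [← List.prod_cons, h.prod_eq, hprod]
      have h3 := congrArg (fun g : Perm α => g a) h2
      rw [MulAction.mem_stabilizer_iff, Perm.smul_def] at h1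
      simp [h1] at h3
      exact absurd h3 hx

end Transpositions

/-! ### The monoid of components -/

section Component

variable {G : Type*} [Group G] {c : Set G}

/-- The component represented by a tuple of elements of `c` of product `1`. -/
def component (l : List G) (h : (∀ g ∈ l, g ∈ c) ∧ l.prod = 1) : Components c :=
  Con.toQuotient (⟨FreeMonoid.ofList l, h⟩ : componentTuples c)

theorem component_eq_iff {l l' : List G} (h : (∀ g ∈ l, g ∈ c) ∧ l.prod = 1)
    (h' : (∀ g ∈ l', g ∈ c) ∧ l'.prod = 1) :
    component l h = component l' h' ↔ BraidEquiv l l' :=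
  Con.eq _

theorem component_surjective (x : Components c) : ∃ l h, x = component l h := by
  induction x using Con.induction_on with
  | H x => exact ⟨x.1.toList, x.2, rfl⟩

end Component

section DoubledTransposition

variable {d : ℕ}

/-- The component of the pair `(t, t)`, where `t` is a transposition. -/
def doubled (t : transpositions d) : Components (transpositions d) :=
  component [t.1, t.1] ⟨by simp, by
    obtain ⟨_, x, y, _, rfl⟩ := t
    simp⟩

/-- The transposition `(i j)`. -/
def transposition (i j : Fin d) (h : i ≠ j) : transpositions d := ⟨swap i j, i, j, h, rfl⟩

theorem doubled_transposition (p : IndexPair d) :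
    doubled (transposition p.1.1 p.1.2 p.2.ne) = pairComponent p := rfl

theorem doubled_transposition_comm (i j : Fin d) (h : i ≠ j) :
    doubled (transposition i j h) = doubled (transposition j i h.symm) := by
  congr 1
  exact Subtype.ext (swap_comm i j)

theorem doubled_mem_range (t : transpositions d) :
    doubled t ∈ Set.range (pairComponent (d := d)) := by
  obtain ⟨_, i, j, hij, rfl⟩ := t
  rcases hij.lt_or_gt with h | h
  · exact ⟨⟨(i, j), h⟩, rfl⟩
  · exact ⟨⟨(j, i), h⟩, doubled_transposition_comm j i hij.symm⟩

/-- The basic relation of the ring of components: `X_{ij} X_{jm} = X_{ij} X_{im}`. -/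
theorem doubled_mul_doubled {i j m : Fin d} (hij : i ≠ j) (hjm : j ≠ m) (him : i ≠ m) :
    doubled (transposition i j hij) * doubled (transposition j m hjm) =
      doubled (transposition i j hij) * doubled (transposition i m him) := by
  refine (component_eq_iff (c := transpositions d) ?_ ?_).mpr ?_
  have h := BraidEquiv.conj_pair (swap_mul_self j m) (swap i j)
  rw [← Equiv.swap_apply_apply, swap_apply_right, swap_apply_of_ne_of_ne him.symm hjm.symm] at h
  exact h

theorem closure_pairComponent :
    Submonoid.closure (Set.range (pairComponent (d := d))) = ⊤ := by
  rw [eq_top_iff]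
  rintro x -
  obtain ⟨l, hl, rfl⟩ := component_surjective x
  induction hn : l.length using Nat.strong_induction_on generalizing l with
  | _ n ih =>
    rcases eq_or_ne l [] with rfl | hne
    · exact one_mem _
    · obtain ⟨t, l', h⟩ := BraidEquiv.exists_pair hne hl.1 hl.2
      have h1 : ∀ g ∈ t :: t :: l', g ∈ transpositions d := h.forall_mem
        (fun _ _ b => Perm.IsSwap.conj_mem_iff b) hl.1
      have h2 : (t :: t :: l').prod = 1 := h.prod_eq.trans hl.2
      have ht : t ∈ transpositions d := h1 t (by simp)
      have htt : t * t = 1 := by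
        obtain ⟨x, y, _, rfl⟩ := ht
        simp
      have hl' : (∀ g ∈ l', g ∈ transpositions d) ∧ l'.prod = 1 :=
        ⟨fun g hg => h1 g (by simp [hg]), by
          simpa [← mul_assoc, htt] using h2⟩
      have hlen := h.length_eq
      simp only [List.length_cons] at hlen
      have h3 : component l hl = doubled ⟨t, ht⟩ * component l' hl' :=
        (component_eq_iff hl ⟨h1, h2⟩).mpr h
      rw [h3]
      exact mul_mem (Submonoid.subset_closure (doubled_mem_range _))
        (ih _ (by omega) l' hl' rfl)

theorem aeval_generatorX_surjective (k : Type*) [Field k] :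
    Function.Surjective (MvPolynomial.aeval (generatorX k) :
      MvPolynomial (IndexPair d) k →ₐ[k] RingOfComponents k (transpositions d)) := by
  rw [← AlgHom.range_eq_top, ← Algebra.adjoin_range_eq_range_aeval, eq_top_iff]
  have h : ∀ x : Components (transpositions d), MonoidAlgebra.of k _ x ∈
      Algebra.adjoin k (Set.range (generatorX k (d := d))) := by
    intro x
    have hx : x ∈ Submonoid.closure (Set.range (pairComponent (d := d))) := by
      rw [closure_pairComponent]; trivial
    induction hx using Submonoid.closure_induction with
    | mem x hx =>
      obtain ⟨p, rfl⟩ := hx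
      exact Algebra.subset_adjoin ⟨p, rfl⟩
    | one => rw [map_one]; exact one_mem _
    | mul x y _ _ hx hy => rw [map_mul]; exact mul_mem hx hy
  rintro f -
  induction f using MonoidAlgebra.induction_on with
  | of x => exact h x
  | add f g hf hg => exact add_mem hf hg
  | smul r f hf => exact Subalgebra.smul_mem _ hf r

end DoubledTransposition

/-! ### Blocks of a homomorphism to a domain -/

section Blocks

/-- If a symmetric matrix over a domain satisfies `y i j * y j m = y i j * y i m`, then its
nonzero off-diagonal entries define an equivalence relation, and are constant on each class:
`ρ` picks a representative of each class and `z` is the value attached to it. -/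
theorem exists_blocks {ι S : Type*} [CommRing S] [IsDomain S] (y : ι → ι → S)
    (symm : ∀ i j, i ≠ j → y i j = y j i)
    (rel : ∀ i j m, i ≠ j → j ≠ m → i ≠ m → y i j * y j m = y i j * y i m) :
    ∃ (ρ : ι → ι) (z : ι → S), ∀ i j, i ≠ j → (y i j = open Classical in
      if ρ i = ρ j then z (ρ i) else 0) := by
  classical
  have rel' : ∀ i j m, i ≠ j → j ≠ m → i ≠ m → y i j ≠ 0 → y j m = y i m :=
    fun i j m hij hjm him h => mul_left_cancel₀ h (rel i j m hij hjm him)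
  let s : Setoid ι :=
    { r := fun i j => i = j ∨ y i j ≠ 0
      iseqv := by
        refine ⟨fun _ => .inl rfl, fun {i j} h => ?_, fun {i j m} h h' => ?_⟩
        · grind
        · by_cases hij : i = j
          · exact hij ▸ h'
          by_cases hjm : j = m
          · exact hjm ▸ h
          by_cases him : i = m
          · exact .inl him
          · right
            rw [← rel' i j m hij hjm him (h.resolve_left hij)]
            exact h'.resolve_left hjm }
  have hs : ∀ i j, s.r i j ↔ i = j ∨ y i j ≠ 0 := fun _ _ => Iff.rfl
  have hout : ∀ i, s.r (Quotient.mk s i).out i := fun i => Quotient.mk_out i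
  have hρ : ∀ i j, (Quotient.mk s i).out = (Quotient.mk s j).out ↔ i = j ∨ y i j ≠ 0 := by
    intro i j
    rw [Quotient.out_inj, Quotient.eq (r := s)]
    exact Iff.rfl
  -- Two nonzero entries in the same row agree, so each row is constant on its class.
  have row : ∀ m j j', m ≠ j → m ≠ j' → y m j ≠ 0 → y m j' ≠ 0 → y m j = y m j' := by
    grind
  let z : ι → S := fun m => if h : ∃ j, m ≠ j ∧ y m j ≠ 0 then y m h.choose else 0
  have hz : ∀ m j, m ≠ j → y m j ≠ 0 → z m = y m j := by
    intro m j hmj h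
    have hex : ∃ j, m ≠ j ∧ y m j ≠ 0 := ⟨j, hmj, h⟩
    exact (dif_pos hex).trans
      (row m _ j hex.choose_spec.1 hmj hex.choose_spec.2 h)
  refine ⟨fun i => (Quotient.mk s i).out, z, fun i j hij => ?_⟩
  simp only [hρ, hij, false_or]
  by_cases h0 : y i j = 0
  · simp [h0]
  rw [if_pos h0]
  have hi := hout i
  have hj := hout j
  rw [← (hρ i j).mpr (.inr h0)] at hj
  generalize (Quotient.mk s i).out = m at hi hj
  rw [hs] at hi hj
  by_cases hmi : m = i
  · subst hmi
    exact (hz m j hij h0).symm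
  · have h1 : y i m ≠ 0 := by
      rw [symm i m (Ne.symm hmi)]
      exact hi.resolve_left hmi
    rw [hz m i hmi (hi.resolve_left hmi), symm m i hmi]
    exact row i j m hij (Ne.symm hmi) h0 h1

/-- At most `d / 2` fibres of a map from a set with `d` elements have two elements or more. -/
theorem card_nontrivial_fibers_le {ι κ : Type*} [Fintype ι] [Finite κ] (ρ : ι → κ) :
    Nat.card {m : κ // ∃ i j, i ≠ j ∧ ρ i = m ∧ ρ j = m} ≤ Fintype.card ι / 2 := by
  classical
  have := Fintype.ofFinite κ
  rw [Nat.card_eq_fintype_card, Fintype.card_subtype, Nat.le_div_iff_mul_le two_pos,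
    ← Finset.card_univ, Finset.card_eq_sum_card_fiberwise (f := ρ) (t := Finset.univ) (by simp),
    ← smul_eq_mul]
  refine (Finset.card_nsmul_le_sum _ (fun m => (Finset.univ.filter (ρ · = m)).card) 2 ?_).trans
    (Finset.sum_le_sum_of_subset (Finset.subset_univ _))
  intro m hm
  obtain ⟨i, j, hij, hi, hj⟩ := (Finset.mem_filter.mp hm).2
  exact Finset.one_lt_card.mpr ⟨i, by simpa, j, by simpa, hij⟩

variable {k : Type*} [Field k] {d : ℕ}

/-- A homomorphism from the ring of components to a domain kills `X_{ij}` unless `i` and `j` lie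
in the same block of some partition, and its value on `X_{ij}` depends only on the block. -/
theorem exists_blocks_of_algHom {S : Type*} [CommRing S] [IsDomain S] [Algebra k S]
    (φ : RingOfComponents k (transpositions d) →ₐ[k] S) :
    ∃ (ρ : Fin d → Fin d) (z : Fin d → S), ∀ p : IndexPair d,
      φ (generatorX k p) = if ρ p.1.1 = ρ p.1.2 then z (ρ p.1.1) else 0 := by
  have hy : ∀ i j (h : i ≠ j), (if h : i ≠ j then
      φ (MonoidAlgebra.of k _ (doubled (transposition i j h))) else 0) =
      φ (MonoidAlgebra.of k _ (doubled (transposition i j h))) := fun i j h => dif_pos h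
  obtain ⟨ρ, z, h⟩ := exists_blocks (fun i j : Fin d => if h : i ≠ j then
    φ (MonoidAlgebra.of k _ (doubled (transposition i j h))) else 0)
    (fun i j h => by
      rw [hy i j h, hy j i h.symm, doubled_transposition_comm])
    (fun i j m hij hjm him => by
      rw [hy i j hij, hy j m hjm, hy i m him, ← map_mul, ← map_mul, ← map_mul, ← map_mul,
        doubled_mul_doubled hij hjm him])
  refine ⟨ρ, z, fun p => ?_⟩
  have h1 := h p.1.1 p.1.2 p.2.ne
  rw [hy _ _ p.2.ne, doubled_transposition] at h1
  rw [generatorX, h1]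
  congr

end Blocks

/-! ### Points attached to families of disjoint sets -/

section Weight

variable {d : ℕ} {ι : Type*} [Fintype ι] {A : ι → Finset (Fin d)} {K : Type*} [CommRing K]

/-- The weight of a permutation: `s m` if its support lies in the block `A m`, and zero if its
support lies in no block. The value at permutations whose support lies in several disjoint blocks,
that is, at the identity, is irrelevant. -/
def blockWeight (A : ι → Finset (Fin d)) (s : ι → K) (g : Perm (Fin d)) : K :=
  ∑ m, if g.support ⊆ A m then s m else 0

/-- A permutation of nonzero weight is supported in one block, so it preserves all the blocks and
conjugation by it preserves the weight. -/
theorem blockWeight_conj (hA : ∀ i j, i ≠ j → Disjoint (A i) (A j)) (s : ι → K)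
    (a b : Perm (Fin d)) :
    blockWeight A s (a * b * a⁻¹) * blockWeight A s a = blockWeight A s a * blockWeight A s b := by
  by_cases h : ∃ m, a.support ⊆ A m
  · obtain ⟨m, hm⟩ := h
    have key : ∀ m', (A m').map a.toEmbedding = A m' := by
      intro m'
      refine Finset.eq_of_subset_of_card_le (fun y hy => ?_) (by simp)
      obtain ⟨x, hx, rfl⟩ := Finset.mem_map.mp hy
      by_cases hax : a x = x
      · simpa [hax] using hx
      · have hxs : x ∈ a.support := Perm.mem_support.mpr hax
        have hmm : m = m' := by
          by_contra hne
          exact Finset.disjoint_left.mp (hA _ _ hne) (hm hxs) hx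
        subst hmm
        exact hm (Perm.apply_mem_support.mpr hxs)
    rw [mul_comm]
    congr 1
    refine Finset.sum_congr rfl fun m' _ => ?_
    congr 1
    rw [Perm.support_conj]
    nth_rw 1 [← key m']
    rw [Finset.map_subset_map]
  · have h0 : blockWeight A s a = 0 :=
      Finset.sum_eq_zero fun m _ => if_neg fun hm => h ⟨m, hm⟩
    rw [h0, mul_zero, zero_mul]

theorem blockWeight_swap (s : ι → K) {i j : Fin d} (hij : i ≠ j) :
    blockWeight A s (swap i j) = ∑ m, if i ∈ A m ∧ j ∈ A m then s m else 0 := by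
  simp [blockWeight, Perm.support_swap hij, Finset.insert_subset_iff]

theorem blockWeight_swap_mul_self (hA : ∀ i j, i ≠ j → Disjoint (A i) (A j)) (s : ι → K)
    {i j : Fin d} (hij : i ≠ j) :
    blockWeight A s (swap i j) * blockWeight A s (swap i j) =
      ∑ m, if i ∈ A m ∧ j ∈ A m then s m * s m else 0 := by
  rw [blockWeight_swap s hij, Finset.sum_mul_sum]
  refine Finset.sum_congr rfl fun m _ => ?_
  rw [Finset.sum_eq_single m]
  · split_ifs <;> simp
  · intro m' _ hne
    by_cases h : i ∈ A m ∧ j ∈ A m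
    · rw [if_neg (c := i ∈ A m' ∧ j ∈ A m'), mul_zero]
      exact fun h' => Finset.disjoint_left.mp (hA _ _ hne) h'.1 h.1
    · rw [if_neg h, zero_mul]
  · simp

theorem BraidEquiv.prod_blockWeight (hA : ∀ i j, i ≠ j → Disjoint (A i) (A j)) (s : ι → K)
    {l l' : List (Perm (Fin d))} (h : BraidEquiv l l') :
    (l'.map (blockWeight A s)).prod = (l.map (blockWeight A s)).prod :=
  h.apply_eq (fun l => (l.map (blockWeight A s)).prod) fun u v a b => by
    simp only [List.map_append, List.map_cons, List.prod_append, List.prod_cons]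
    rw [← mul_assoc (blockWeight A s _), blockWeight_conj hA, mul_assoc]

/-- The product of the weights of the entries of a tuple, as a homomorphism on the monoid of
components. -/
def weightHom (hA : ∀ i j, i ≠ j → Disjoint (A i) (A j)) (s : ι → K) :
    Components (transpositions d) →* K :=
  Con.lift _ ((FreeMonoid.lift (blockWeight A s)).comp (componentTuples _).subtype)
    fun x y h => by
      have h' : BraidEquiv x.1.toList y.1.toList := h
      simpa [FreeMonoid.lift_apply] using (h'.prod_blockWeight hA s).symm

theorem weightHom_component (hA : ∀ i j, i ≠ j → Disjoint (A i) (A j)) (s : ι → K)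
    (l : List (Perm (Fin d))) (h : (∀ g ∈ l, g ∈ transpositions d) ∧ l.prod = 1) :
    weightHom hA s (component l h) = (l.map (blockWeight A s)).prod := by
  refine (Con.lift_coe _ _).trans ?_
  exact FreeMonoid.lift_ofList _ l

variable (k : Type*) [Field k] [Algebra k K]

/-- The homomorphism from the ring of components that sends `X_{ij}` to `s m ^ 2` if `i` and `j`
both lie in the block `A m`, and to zero if they lie in no common block. -/
noncomputable def weightAlgHom (hA : ∀ i j, i ≠ j → Disjoint (A i) (A j)) (s : ι → K) :
    RingOfComponents k (transpositions d) →ₐ[k] K :=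
  MonoidAlgebra.lift k K _ (weightHom hA s)

theorem weightAlgHom_generatorX (hA : ∀ i j, i ≠ j → Disjoint (A i) (A j)) (s : ι → K)
    (p : IndexPair d) :
    weightAlgHom k hA s (generatorX k p) =
      ∑ m, if p.1.1 ∈ A m ∧ p.1.2 ∈ A m then s m * s m else 0 := by
  rw [weightAlgHom, generatorX, MonoidAlgebra.lift_of, ← blockWeight_swap_mul_self hA s p.2.ne]
  refine (weightHom_component hA s _ _).trans ?_
  simp

theorem comp_weightAlgHom {L : Type*} [CommRing L] [Algebra k L] (f : K →ₐ[k] L)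
    (hA : ∀ i j, i ≠ j → Disjoint (A i) (A j)) (s : ι → K) :
    f.comp (weightAlgHom k hA s) = weightAlgHom k hA (f ∘ s) := by
  rw [← AlgHom.cancel_right (aeval_generatorX_surjective k)]
  refine MvPolynomial.algHom_ext fun p => ?_
  simp [weightAlgHom_generatorX, apply_ite f]

end Weight

/-! ### The set of points -/

section Points

variable (k : Type*) [Field k] {d : ℕ}

theorem subsetVector_apply (A : Finset (Fin d)) (p : IndexPair d) :
    subsetVector k A p = if p.1.1 ∈ A ∧ p.1.2 ∈ A then 1 else 0 := by
  simp [subsetVector, Finset.sum_apply, Pi.single_apply, Finset.sum_ite_eq]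

theorem range_affineCoords [IsAlgClosed k] : Set.range (affineCoords k d) =
      {v | ∃ (l : ℕ) (A : Fin l → Finset (Fin d)), (∀ i j, i ≠ j → Disjoint (A i) (A j)) ∧
        v ∈ Submodule.span k (Set.range fun i => subsetVector k (A i))} := by
  ext v
  constructor
  · rintro ⟨x, rfl⟩
    obtain ⟨ρ, z, h⟩ := exists_blocks_of_algHom
      (show RingOfComponents k (transpositions d) →ₐ[k] k from x)
    refine ⟨d, fun m => Finset.univ.filter (ρ · = m), fun i j hij => ?_, ?_⟩
    · exact Finset.disjoint_filter.mpr fun x _ h1 h2 => hij (h1.symm.trans h2)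
    · rw [Submodule.mem_span_range_iff_exists_fun]
      refine ⟨z, funext fun p => ?_⟩
      rw [affineCoords, h]
      simp only [Finset.sum_apply, Pi.smul_apply, subsetVector_apply, Finset.mem_filter,
        Finset.mem_univ, true_and, smul_eq_mul, mul_ite, mul_one, mul_zero]
      rw [Finset.sum_eq_single (ρ p.1.1)]
      · simp [eq_comm]
      · intro m _ hm
        simp [hm.symm]
      · simp
  · rintro ⟨l, A, hA, hv⟩
    obtain ⟨c, rfl⟩ := Submodule.mem_span_range_iff_exists_fun k |>.mp hv
    choose s hs using fun i => IsAlgClosed.exists_eq_mul_self (c i)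
    refine ⟨weightAlgHom k hA s, funext fun p => ?_⟩
    refine (weightAlgHom_generatorX k hA s p).trans ?_
    simp [Finset.sum_apply, subsetVector_apply, hs]

end Points

/-! ### The dimension -/

section Dimension

variable {k : Type*} [Field k]

/-- The algebra homomorphism underlying a `k`-point. -/
def KPoints.toAlgHom {R : Type*} [CommRing R] [Algebra k R] (x : KPoints k R) : R →ₐ[k] k := x

theorem KPoints.isClosed_setOf_eq_zero {R : Type*} [CommRing R] [Algebra k R] (r : R) :
    IsClosed {x : KPoints k R | x.toAlgHom r = 0} := by
  have h : {x : KPoints k R | x.toAlgHom r = 0} =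
      KPoints.toSpec ⁻¹' PrimeSpectrum.zeroLocus {r} := by
    ext x
    rw [Set.mem_preimage, PrimeSpectrum.mem_zeroLocus, Set.singleton_subset_iff]
    exact Iff.rfl
  rw [h]
  exact (PrimeSpectrum.isClosed_zeroLocus _).preimage continuous_induced_dom

theorem KPoints.exists_of_isOpen {R : Type*} [CommRing R] [Algebra k R] {u : Set (KPoints k R)}
    (hu : IsOpen u) {x : KPoints k R} (hx : x ∈ u) :
    ∃ r : R, x.toAlgHom r ≠ 0 ∧ ∀ y : KPoints k R, y.toAlgHom r ≠ 0 → y ∈ u := by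
  obtain ⟨U, hU, rfl⟩ := isOpen_induced_iff.mp hu
  obtain ⟨_, ⟨r, rfl⟩, hr, hrU⟩ :=
    PrimeSpectrum.isTopologicalBasis_basic_opens.exists_subset_of_mem_open hx hU
  exact ⟨r, hr, fun y hy => hrU hy⟩

/-- The points obtained from one homomorphism to a polynomial ring by specializing the variables
form an irreducible set. -/
theorem KPoints.isIrreducible_range_aeval [Infinite k] {R σ : Type*} [CommRing R] [Algebra k R]
    (φ : R →ₐ[k] MvPolynomial σ k) :
    IsIrreducible (Set.range fun s : σ → k =>
      show KPoints k R from (MvPolynomial.aeval s).comp φ) := by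
  refine ⟨Set.range_nonempty _, fun u v hu hv => ?_⟩
  rintro ⟨_, ⟨s, rfl⟩, hsu⟩ ⟨_, ⟨t, rfl⟩, htv⟩
  obtain ⟨f, hf, hfu⟩ := KPoints.exists_of_isOpen hu hsu
  obtain ⟨g, hg, hgv⟩ := KPoints.exists_of_isOpen hv htv
  have hf0 : φ f ≠ 0 := fun h => hf (by
    change MvPolynomial.aeval s (φ f) = 0
    rw [h, map_zero])
  have hg0 : φ g ≠ 0 := fun h => hg (by
    change MvPolynomial.aeval t (φ g) = 0
    rw [h, map_zero])
  obtain ⟨w, hw⟩ : ∃ w : σ → k, MvPolynomial.eval w (φ f * φ g) ≠ 0 := by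
    by_contra! h
    exact mul_ne_zero hf0 hg0 (MvPolynomial.funext fun w => by rw [h, map_zero])
  rw [map_mul] at hw
  refine ⟨_, ⟨w, rfl⟩, hfu _ ?_, hgv _ ?_⟩
  · change MvPolynomial.aeval w (φ f) ≠ 0
    rw [MvPolynomial.aeval_eq_eval]
    exact left_ne_zero_of_mul hw
  · change MvPolynomial.aeval w (φ g) ≠ 0
    rw [MvPolynomial.aeval_eq_eval]
    exact right_ne_zero_of_mul hw

/-- The dimension of a ring is bounded by that of its quotients by prime ideals. -/
theorem ringKrullDim_le_of_forall_prime {R : Type*} [CommRing R] (b : WithBot ℕ∞)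
    (h : ∀ P : Ideal R, P.IsPrime → ringKrullDim (R ⧸ P) ≤ b) : ringKrullDim R ≤ b := by
  refine iSup_le fun p => ?_
  refine le_trans ?_ (h p.head.asIdeal p.head.isPrime)
  rw [ringKrullDim_quotient]
  let q : LTSeries (PrimeSpectrum.zeroLocus (R := R) p.head.asIdeal) :=
    { length := p.length
      toFun := fun i => ⟨p i, p.monotone (Fin.zero_le i)⟩
      step := fun i => p.step i }
  exact Order.LTSeries.length_le_krullDim q

variable (k) (d : ℕ)

/-- Modulo a prime, the ring of components is generated by one element for each block with two
elements or more, and there are at most `d / 2` such blocks. -/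
theorem ringKrullDim_ringOfComponents_le :
    ringKrullDim (RingOfComponents k (transpositions d)) ≤ ((d / 2 : ℕ) : WithBot ℕ∞) := by
  refine ringKrullDim_le_of_forall_prime _ fun P hP => ?_
  obtain ⟨ρ, z, h⟩ := exists_blocks_of_algHom (Ideal.Quotient.mkₐ k P)
  let M := {m : Fin d // ∃ i j, i ≠ j ∧ ρ i = m ∧ ρ j = m}
  let F : MvPolynomial M k →ₐ[k] _ ⧸ P := MvPolynomial.aeval fun m => z m
  have hF : Function.Surjective F := by
    rw [← AlgHom.range_eq_top, eq_top_iff]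
    have h1 : ((Ideal.Quotient.mkₐ k P).comp (MvPolynomial.aeval (generatorX k))).range = ⊤ :=
      (AlgHom.range_eq_top _).mpr
        ((Ideal.Quotient.mkₐ_surjective k P).comp (aeval_generatorX_surjective k))
    rw [← h1, MvPolynomial.comp_aeval, ← Algebra.adjoin_range_eq_range_aeval,
      Algebra.adjoin_le_iff]
    rintro _ ⟨p, rfl⟩
    rw [SetLike.mem_coe]
    change Ideal.Quotient.mkₐ k P (generatorX k p) ∈ F.range
    rw [h]
    split_ifs with hp
    · exact ⟨MvPolynomial.X ⟨ρ p.1.1, p.1.1, p.1.2, p.2.ne, rfl, hp.symm⟩,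
        MvPolynomial.aeval_X _ _⟩
    · exact zero_mem _
  refine (ringKrullDim_le_of_surjective F.toRingHom hF).trans ?_
  rw [MvPolynomial.ringKrullDim_of_isNoetherianRing, ringKrullDim_eq_zero_of_field, zero_add]
  have hM := card_nontrivial_fibers_le ρ
  rw [Fintype.card_fin] at hM
  exact_mod_cast hM

theorem topologicalKrullDim_kPoints_le :
    topologicalKrullDim (KPoints k (RingOfComponents k (transpositions d))) ≤
      ((d / 2 : ℕ) : WithBot ℕ∞) := by
  have h : Topology.IsInducing
      (KPoints.toSpec (k := k) (R := RingOfComponents k (transpositions d))) := ⟨rfl⟩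
  refine h.topologicalKrullDim_le.trans ?_
  rw [PrimeSpectrum.topologicalKrullDim_eq_ringKrullDim]
  exact ringKrullDim_ringOfComponents_le k d

variable {d}

/-- The blocks `{0, 1}, {2, 3}, …`. -/
def pairBlock (m : Fin (d / 2)) : Finset (Fin d) :=
  Finset.univ.filter fun i => (i : ℕ) / 2 = m

theorem pairBlock_disjoint (m m' : Fin (d / 2)) (h : m ≠ m') :
    Disjoint (pairBlock (d := d) m) (pairBlock m') :=
  Finset.disjoint_filter.mpr fun _ _ h1 h2 => h (Fin.ext (h1.symm.trans h2))

/-- The pair of the two elements of a block. -/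
def blockPair (m : Fin (d / 2)) : IndexPair d :=
  ⟨(⟨2 * m, by omega⟩, ⟨2 * m + 1, by omega⟩), by simp [Fin.lt_def]⟩

/-- The point attached to a family of weights on the blocks `{0, 1}, {2, 3}, …`. -/
noncomputable def pairPoint (s : Fin (d / 2) → k) :
    KPoints k (RingOfComponents k (transpositions d)) :=
  weightAlgHom k pairBlock_disjoint s

/-- The points whose weights vanish on the blocks of index `≥ r`. -/
def pairStratum (r : ℕ) : Set (KPoints k (RingOfComponents k (transpositions d))) :=
  Set.range fun s : Fin (d / 2) → k => pairPoint k fun m => if (m : ℕ) < r then s m else 0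

theorem isIrreducible_pairStratum [Infinite k] (r : ℕ) :
    IsIrreducible (pairStratum k (d := d) r) := by
  convert KPoints.isIrreducible_range_aeval (weightAlgHom k (pairBlock_disjoint (d := d))
    fun m => if (m : ℕ) < r then (MvPolynomial.X m : MvPolynomial _ k) else 0) using 1
  refine congrArg Set.range (funext fun s => ?_)
  refine Eq.trans ?_ (comp_weightAlgHom k (MvPolynomial.aeval s) _ _).symm
  congr 1
  ext m
  by_cases h : (m : ℕ) < r <;> simp [h]

theorem pairPoint_blockPair (s : Fin (d / 2) → k) (m : Fin (d / 2)) :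
    (pairPoint k s).toAlgHom (generatorX k (blockPair m)) = s m * s m := by
  refine (weightAlgHom_generatorX k pairBlock_disjoint s _).trans ?_
  rw [Finset.sum_eq_single m]
  · rw [if_pos]
    simp [pairBlock, blockPair]
    omega
  · intro m' _ hm
    rw [if_neg]
    simp only [pairBlock, blockPair, Finset.mem_filter, Finset.mem_univ, true_and]
    intro h
    apply hm
    ext
    omega
  · simp

theorem pairStratum_mono {r r' : ℕ} (h : r ≤ r') :
    pairStratum k (d := d) r ⊆ pairStratum k r' := by
  rintro _ ⟨s, rfl⟩
  refine ⟨fun m => if (m : ℕ) < r then s m else 0, congrArg (pairPoint k) (funext fun m => ?_)⟩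
  grind

/-- The coordinate of the block `r` vanishes on the closure of the stratum of index `r`, but not
on the next stratum. -/
theorem closure_pairStratum_ssubset {r r' : ℕ} (h : r < r') (h' : r' ≤ d / 2) :
    closure (pairStratum k (d := d) r) ⊂ closure (pairStratum k r') := by
  refine (closure_mono (pairStratum_mono k h.le)).ssubset_of_not_subset fun hsub => ?_
  let m : Fin (d / 2) := ⟨r, by omega⟩
  have h1 : closure (pairStratum k (d := d) r) ⊆
      {x | x.toAlgHom (generatorX k (blockPair m)) = 0} := by
    refine closure_minimal ?_ (KPoints.isClosed_setOf_eq_zero _)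
    rintro _ ⟨s, rfl⟩
    refine (pairPoint_blockPair k _ m).trans ?_
    simp [m]
  have h2 := h1 (hsub (subset_closure ⟨fun _ => 1, rfl⟩))
  have h3 := (pairPoint_blockPair k _ m).symm.trans h2
  simp [m, h] at h3

theorem le_topologicalKrullDim_kPoints [Infinite k] : ((d / 2 : ℕ) : WithBot ℕ∞) ≤
    topologicalKrullDim (KPoints k (RingOfComponents k (transpositions d))) := by
  let q : LTSeries (TopologicalSpace.IrreducibleCloseds
      (KPoints k (RingOfComponents k (transpositions d)))) :=
    { length := d / 2
      toFun := fun r => ⟨closure (pairStratum k r), (isIrreducible_pairStratum k r).closure,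
        isClosed_closure⟩
      step := fun r => closure_pairStratum_ssubset k (d := d) (by simp)
        (by simp only [Fin.val_succ]; omega) }
  exact Order.LTSeries.length_le_krullDim q

end Dimension

theorem mainTheorem8 (k : Type*) [Field k] [IsAlgClosed k] (d : ℕ) (hd : 2 ≤ d) :
    Function.Surjective (MvPolynomial.aeval (generatorX k) :
      MvPolynomial (IndexPair d) k →ₐ[k] RingOfComponents k (transpositions d)) ∧
    Set.range (affineCoords k d) =
      {v | ∃ (l : ℕ) (A : Fin l → Finset (Fin d)), (∀ i j, i ≠ j → Disjoint (A i) (A j)) ∧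
        v ∈ Submodule.span k (Set.range fun i => subsetVector k (A i))} ∧
    topologicalKrullDim (KPoints k (RingOfComponents k (transpositions d))) =
      ((d / 2 : ℕ) : WithBot ℕ∞) := by
  exact ⟨aeval_generatorX_surjective k, range_affineCoords k,
    (topologicalKrullDim_kPoints_le k d).antisymm (le_topologicalKrullDim_kPoints k)⟩
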